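/- **Theorem (Hamiltonian Noether's Theorem).** Let $(M,\omega,\theta)$ be an exact symplectic manifold: $M$ is a finite-dimensional smooth manifold, $\omega$ is a smooth, closed, nondegenerate 2-form and $\theta$ is a smooth 1-form with $\omega=-d\theta$. Let $\Phi:\mathbb R^+\times M\to M$ be a smooth action of the multiplicative group $\mathbb R^+$ that is conformally symplectic with parameter $c\in\mathbb R$, i.e. $\Phi_g^*\omega=g^c\,\omega$ for all $g\in\mathbb R^+$. Let $J:M\to\mathbb R$ be a conformal momentum map with parameter $c$ for $\Phi$, i.e. a smooth function such that for every $\xi\in\mathbb R$ (the Lie algebra of $\mathbb R^+$) $$ i_{\xi_M}\omega+(c\,\xi)\,\theta=d(\xi J),\qquad \xi_M(x)=\left.\frac{d}{d\tau}\right|_{\tau=0}\Phi_{e^{\tau\xi}}(x). $$ Let $H:M\to\mathbb R$ be smooth and conformally invariant with parameter $b\in\mathbb R$, i.e. $\Phi_g^*H=g^b\,H$ for all $g\in\mathbb R^+$, and let $X_H$ be its Hamiltonian vector field, the unique vector field with $i_{X_H}\omega=dH$. Then along the flow of $X_H$, that is, along every integral curve $\gamma:I\to M$ of $X_H$ on an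 open interval $I\ni 0$, $$ \frac{dJ}{dt}=-bH+c\,i_{X_H}\theta . $$ Consequently $i_{X_H}\theta$ is integrable along $\gamma$ between $0$ and every $t\in I$, and the function $$ F=J+bHt-c\int_0^t i_{X_H}\theta\,dt, $$ evaluated along $\gamma$, is a constant of motion: $\frac{dF}{dt}=0$ on $I$, so that $F$ is constantly equal to $J(\gamma(0))$. -/

import Mathlib

open scoped Manifold ContDiff

/-! ### Differential forms on a boundaryless manifold modelled on `E` -/

section DifferentialForms

variable (E : Type*) [NormedAddCommGroup E] [NormedSpace ℝ E]
  (M : Type*) [TopologicalSpace M] [ChartedSpace E M]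

/-- A (not necessarily smooth) differential `k`-form on `M`: an alternating `k`-linear form on each
tangent space. -/
abbrev DiffForm (k : ℕ) : Type _ :=
  ∀ x : M, (TangentSpace 𝓘(ℝ, E) x) [⋀^Fin k]→L[ℝ] ℝ

end DifferentialForms

namespace DiffForm

variable {E : Type*} [NormedAddCommGroup E] [NormedSpace ℝ E]
  {M : Type*} [TopologicalSpace M] [ChartedSpace E M]

/-- The expression of a `k`-form in the preferred chart at `x₀`: its pullback along the inverse of
the chart. It is meaningful on the (open) target of the chart. -/
noncomputable def inChart {k : ℕ} (α : DiffForm E M k) (x₀ : M) (y : E) : E [⋀^Fin k]→L[ℝ] ℝ :=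
  (α ((extChartAt 𝓘(ℝ, E) x₀).symm y)).compContinuousLinearMap
    (mfderiv 𝓘(ℝ, E) 𝓘(ℝ, E) (extChartAt 𝓘(ℝ, E) x₀).symm y)

/-- A form is smooth if its expression in each preferred chart is `C^∞`. -/
def IsSmooth {k : ℕ} (α : DiffForm E M k) : Prop :=
  ∀ x₀ : M, ContDiffOn ℝ ∞ (α.inChart x₀) (extChartAt 𝓘(ℝ, E) x₀).target

/-- The exterior derivative: at `x`, take the exterior derivative of the expression in the chart
at `x` and pull it back along that chart. -/
noncomputable def d {k : ℕ} (α : DiffForm E M k) : DiffForm E M (k + 1) := fun x =>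
  (extDeriv (α.inChart x) (extChartAt 𝓘(ℝ, E) x x)).compContinuousLinearMap
    (mfderiv 𝓘(ℝ, E) 𝓘(ℝ, E) (extChartAt 𝓘(ℝ, E) x) x)

/-- The pullback `f^* α` of a form under a map `f : M → M`. -/
noncomputable def pullback {k : ℕ} (f : M → M) (α : DiffForm E M k) : DiffForm E M k := fun x =>
  (α (f x)).compContinuousLinearMap (mfderiv 𝓘(ℝ, E) 𝓘(ℝ, E) f x)

end DiffForm

/-- The differential `dF` of a function `F : M → ℝ`. -/
noncomputable def differential {E : Type*} [NormedAddCommGroup E] [NormedSpace ℝ E]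
    {M : Type*} [TopologicalSpace M] [ChartedSpace E M] (F : M → ℝ) (x : M) :
    TangentSpace 𝓘(ℝ, E) x →L[ℝ] ℝ :=
  mfderiv 𝓘(ℝ, E) 𝓘(ℝ, ℝ) F x

/-- The data `(ω, θ)` of an exact symplectic manifold `(M, ω, θ)`: a smooth, closed, nondegenerate
2-form `ω` together with a chosen smooth primitive one-form `θ`, `ω = -dθ`. -/
structure ExactSymplectic (E : Type*) [NormedAddCommGroup E] [NormedSpace ℝ E]
    (M : Type*) [TopologicalSpace M] [ChartedSpace E M] where
  /-- the symplectic form -/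
  omega : DiffForm E M 2
  /-- the symplectic potential -/
  theta : DiffForm E M 1
  smooth_omega : omega.IsSmooth
  smooth_theta : theta.IsSmooth
  closed : omega.d = 0
  nondegenerate : ∀ (x : M) (v : TangentSpace 𝓘(ℝ, E) x),
    (∀ w : TangentSpace 𝓘(ℝ, E) x, omega x ![v, w] = 0) → v = 0
  exact : omega = -theta.d

/-! ### Hamiltonian vector fields -/

namespace ExactSymplectic

variable {E : Type*} [NormedAddCommGroup E] [NormedSpace ℝ E]
  {M : Type*} [TopologicalSpace M] [ChartedSpace E M]

/-- By nondegeneracy, every linear form on a (finite dimensional) tangent space is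
`w ↦ ω(v, w)` for a unique `v`. -/
theorem existsUnique_interior_eq [FiniteDimensional ℝ E] (S : ExactSymplectic E M) (x : M)
    (ℓ : TangentSpace 𝓘(ℝ, E) x →L[ℝ] ℝ) :
    ∃! v : TangentSpace 𝓘(ℝ, E) x, ∀ w : TangentSpace 𝓘(ℝ, E) x, S.omega x ![v, w] = ℓ w := by
  let f : E [⋀^Fin 2]→L[ℝ] ℝ := S.omega x
  have hup (v u u' : E) : Function.update ![v, u'] 1 u = ![v, u] := by
    funext i
    fin_cases i <;> rfl
  let B : E →ₗ[ℝ] Module.Dual ℝ E := LinearMap.mk₂ ℝ (fun v w : E => f ![v, w])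
    (fun v v' w => f.toAlternatingMap.map_vecCons_add ![w] v v')
    (fun a v w => f.toAlternatingMap.map_vecCons_smul ![w] a v)
    (fun v w w' => by simpa only [hup] using f.map_update_add ![v, 0] 1 w w')
    (fun a v w => by simpa only [hup] using f.map_update_smul ![v, 0] 1 a w)
  have hinj : Function.Injective B := by
    rw [injective_iff_map_eq_zero]
    intro v hv
    exact S.nondegenerate x v fun w => LinearMap.congr_fun hv w
  have hsurj : Function.Surjective B :=
    (LinearMap.injective_iff_surjective_of_finrank_eq_finrank
      (Subspace.dual_finrank_eq (K := ℝ) (V := E)).symm).1 hinj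
  obtain ⟨v, hv⟩ := hsurj (ℓ : E →L[ℝ] ℝ).toLinearMap
  refine ⟨v, fun w => LinearMap.congr_fun hv w, fun v' hv' => hinj ?_⟩
  rw [hv]
  exact LinearMap.ext hv'

/-- The Hamiltonian vector field `X_H` of `H`, the unique solution of `i_{X_H} ω = dH`. -/
noncomputable def hamiltonianVectorField [FiniteDimensional ℝ E] (S : ExactSymplectic E M)
    (H : M → ℝ) (x : M) : TangentSpace 𝓘(ℝ, E) x :=
  (S.existsUnique_interior_eq x (differential H x)).choose

theorem hamiltonianVectorField_spec [FiniteDimensional ℝ E] (S : ExactSymplectic E M)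
    (H : M → ℝ) (x : M) (w : TangentSpace 𝓘(ℝ, E) x) :
    S.omega x ![S.hamiltonianVectorField H x, w] = differential H x w :=
  (S.existsUnique_interior_eq x (differential H x)).choose_spec.1 w

end ExactSymplectic

/-! ### Actions of the multiplicative group of positive reals -/

/-- The multiplicative group `ℝ⁺` of positive real numbers. -/
abbrev PosReal : Type := {g : ℝ // 0 < g}

/-- `ℝ⁺` is an open subset of `ℝ`, so that the inclusion is a global chart. -/
noncomputable instance PosReal.instChartedSpace : ChartedSpace ℝ PosReal :=
  (isOpen_Ioi (a := (0 : ℝ))).isOpenEmbedding_subtypeVal.singletonChartedSpace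

/-- The exponential map `ξ ↦ e^ξ` from the Lie algebra `ℝ` of `ℝ⁺` to `ℝ⁺`. -/
noncomputable def PosReal.exp (ξ : ℝ) : PosReal := ⟨Real.exp ξ, Real.exp_pos ξ⟩

section Actions

variable {E : Type*} [NormedAddCommGroup E] [NormedSpace ℝ E]
  {M : Type*} [TopologicalSpace M] [ChartedSpace E M] [MulAction PosReal M]

/-- The infinitesimal generator `ξ_M(x) = d/dτ|_{τ=0} Φ_{e^{τξ}}(x)` of an action of `ℝ⁺`
(the curve is at `x` for `τ = 0`). -/
noncomputable def infinitesimalGenerator (E : Type*) [NormedAddCommGroup E] [NormedSpace ℝ E]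
    {M : Type*} [TopologicalSpace M] [ChartedSpace E M] [MulAction PosReal M]
    (ξ : ℝ) (x : M) : TangentSpace 𝓘(ℝ, E) x :=
  (mfderiv 𝓘(ℝ, ℝ) 𝓘(ℝ, E) (fun τ : ℝ => PosReal.exp (τ * ξ) • x) 0 (1 : ℝ) : E)

namespace ExactSymplectic

/-- The action is conformally symplectic with parameter `c`: `Φ_g^* ω = g^c ω` for all `g`. -/
def IsConformallySymplecticAction (S : ExactSymplectic E M) (c : ℝ) : Prop :=
  ∀ g : PosReal, S.omega.pullback (fun x => g • x) = ((g : ℝ) ^ c) • S.omega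

/-- `J` is a conformal momentum map with parameter `c`:
`i_{ξ_M} ω + (c ξ) θ = dJ_ξ` for all `ξ`, where `J_ξ = ξ J`. -/
structure IsConformalMomentumMap (S : ExactSymplectic E M) (c : ℝ) (J : M → ℝ) : Prop where
  smooth : ContMDiff 𝓘(ℝ, E) 𝓘(ℝ, ℝ) ∞ J
  interior_add : ∀ (ξ : ℝ) (x : M) (v : TangentSpace 𝓘(ℝ, E) x),
    S.omega x ![infinitesimalGenerator E ξ x, v] + (c * ξ) * S.theta x ![v] =
      differential (fun z => ξ * J z) x v

end ExactSymplectic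

end Actions

/-- `F` is conformally invariant with parameter `b`: `Φ_g^* F = g^b F` for all `g`. -/
def IsConformallyInvariant {M : Type*} [MulAction PosReal M] (b : ℝ) (F : M → ℝ) : Prop :=
  ∀ (g : PosReal) (x : M), F (g • x) = (g : ℝ) ^ b * F x

/-! Contracting the momentum map identity for ξ = 1 with X_H gives dJ(X_H) = ω(1_M, X_H) + cθ(X_H) =
-dH(1_M) + cθ(X_H), and differentiating H(Φ_{e^τ} x) = e^{bτ} H(x) at τ = 0 gives dH(1_M) = bH.
Since ω(X_H, X_H) = 0, H is constant along γ, so bHt has derivative bH and the terms of dF/dt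
cancel. The analytic point is the continuity of i_{X_H}θ, needed for integrability and the
fundamental theorem of calculus, because X_H is only chosen pointwise. In a chart, i_{X_H}θ is θ
evaluated at the inverse of v ↦ ω(v, ·) applied to dH, and inversion is continuous at invertible
operators (`theta_hamiltonianVectorField_chart`). -/

open Set

/-! ### Alternating 2-forms as linear maps into the dual. -/

section LinearAlgebra

variable {E : Type*} [NormedAddCommGroup E] [NormedSpace ℝ E]

/-- The linear map `v ↦ α(v, ·)` of an alternating 2-form `α`. -/
noncomputable def ContinuousAlternatingMap.interiorProduct (α : E [⋀^Fin 2]→L[ℝ] ℝ) :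
    E →L[ℝ] E →L[ℝ] ℝ :=
  ((ContinuousAlternatingMap.ofSubsingletonLIE (𝕜 := ℝ) (E := E) (F := ℝ)
    (0 : Fin 1)).symm.toContinuousLinearEquiv : (E [⋀^Fin 1]→L[ℝ] ℝ) →L[ℝ] E →L[ℝ] ℝ) ∘L
    α.curryLeft

theorem ContinuousAlternatingMap.interiorProduct_apply (α : E [⋀^Fin 2]→L[ℝ] ℝ) (v w : E) :
    α.interiorProduct v w = α ![v, w] := by
  change α.curryLeft v (fun _ => w) = _
  rw [ContinuousAlternatingMap.curryLeft_apply_apply]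
  congr 1
  funext i
  fin_cases i <;> rfl

theorem ContinuousAlternatingMap.apply_pair_swap (α : E [⋀^Fin 2]→L[ℝ] ℝ) (v w : E) :
    α ![v, w] = -α ![w, v] := by
  have h := α.toAlternatingMap.map_swap ![w, v] (i := 0) (j := 1) (by decide)
  have e : ![w, v] ∘ Equiv.swap (0 : Fin 2) 1 = ![v, w] := by
    funext i
    fin_cases i <;> rfl
  rw [e] at h
  exact h

theorem ContinuousAlternatingMap.isInvertible_interiorProduct [FiniteDimensional ℝ E]
    (α : E [⋀^Fin 2]→L[ℝ] ℝ) (hα : ∀ v, (∀ w, α ![v, w] = 0) → v = 0) :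
    α.interiorProduct.IsInvertible := by
  have hinj : Function.Injective α.interiorProduct.toLinearMap := by
    rw [injective_iff_map_eq_zero]
    intro v hv
    refine hα v fun w => ?_
    rw [← α.interiorProduct_apply]
    exact congrArg (fun f : E →L[ℝ] ℝ => f w) hv
  have hdim : Module.finrank ℝ E = Module.finrank ℝ (E →L[ℝ] ℝ) := by
    rw [← (LinearMap.toContinuousLinearMap (𝕜 := ℝ) (E := E) (F' := ℝ)).finrank_eq]
    exact (Subspace.dual_finrank_eq (K := ℝ) (V := E)).symm
  exact ⟨(LinearEquiv.ofInjectiveOfFinrankEq _ hinj hdim).toContinuousLinearEquiv, by ext; rfl⟩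

/-- If `i_X α = ℓ` with `α` nondegenerate, then `β(X)` can be computed from the pullbacks of `α`,
`β` and `ℓ` under a linear isomorphism. -/
theorem ContinuousAlternatingMap.apply_eq_inverse_interiorProduct [FiniteDimensional ℝ E]
    (α : E [⋀^Fin 2]→L[ℝ] ℝ) (hα : ∀ v, (∀ w, α ![v, w] = 0) → v = 0)
    (β : E [⋀^Fin 1]→L[ℝ] ℝ) {ℓ : E →L[ℝ] ℝ} {X : E} (hX : ∀ w, α ![X, w] = ℓ w)
    {D : E →L[ℝ] E} (hD : D.IsInvertible) :
    (α.compContinuousLinearMap D).interiorProduct.IsInvertible ∧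
    β ![X] = β.compContinuousLinearMap D
      ![(α.compContinuousLinearMap D).interiorProduct.inverse (ℓ ∘L D)] := by
  obtain ⟨e, rfl⟩ := hD
  have hα' (v w : E) : α.compContinuousLinearMap (e : E →L[ℝ] E) ![v, w] = α ![e v, e w] := by
    change α (fun i => e (![v, w] i)) = _
    congr 1
    funext i
    fin_cases i <;> rfl
  have hβ (v : E) : β.compContinuousLinearMap (e : E →L[ℝ] E) ![v] = β ![e v] := by
    change β (fun i => e (![v] i)) = _
    congr 1
    funext i
    fin_cases i; rfl
  have hB : (α.compContinuousLinearMap (e : E →L[ℝ] E)).interiorProduct.IsInvertible := by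
    refine ContinuousAlternatingMap.isInvertible_interiorProduct _ fun v hv => ?_
    refine e.map_eq_zero_iff.1 (hα _ fun w => ?_)
    have h := hv (e.symm w)
    rwa [hα', e.apply_symm_apply] at h
  refine ⟨hB, ?_⟩
  -- The pulled-back form sends e⁻¹X to ℓ ∘ e, because α(e e⁻¹X, e w) = ℓ(e w).
  have hv : (α.compContinuousLinearMap (e : E →L[ℝ] E)).interiorProduct.inverse (ℓ ∘L e) =
      e.symm X := by
    rw [hB.inverse_apply_eq]
    ext w
    rw [ContinuousAlternatingMap.interiorProduct_apply, hα', e.apply_symm_apply, hX]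
    rfl
  rw [hv, hβ, e.apply_symm_apply]

/-- In finite dimension, continuity in operator norm can be tested on each vector, which reduces it
to evaluating α. -/
theorem ContinuousOn.interiorProduct [FiniteDimensional ℝ E] {X : Type*} [TopologicalSpace X]
    {α : X → E [⋀^Fin 2]→L[ℝ] ℝ} {s : Set X} (hα : ContinuousOn α s) :
    ContinuousOn (fun x => (α x).interiorProduct) s := by
  rw [continuousOn_clm_apply]
  intro v
  rw [continuousOn_clm_apply]
  intro w
  simp only [ContinuousAlternatingMap.interiorProduct_apply]
  exact (continuous_eval_const ![v, w]).comp_continuousOn hα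

end LinearAlgebra

/-! ### Continuity of i_{X_H}θ. -/

namespace ExactSymplectic

variable {E : Type*} [NormedAddCommGroup E] [NormedSpace ℝ E]
  {M : Type*} [TopologicalSpace M] [ChartedSpace E M]

theorem omega_swap (S : ExactSymplectic E M) (x : M) (v w : TangentSpace 𝓘(ℝ, E) x) :
    S.omega x ![v, w] = -S.omega x ![w, v] :=
  ContinuousAlternatingMap.apply_pair_swap (E := E) (S.omega x) v w

/-- Conservation of energy, from ω(X_H, X_H) = 0. -/
theorem differential_hamiltonianVectorField_self [FiniteDimensional ℝ E]
    (S : ExactSymplectic E M) (H : M → ℝ) (x : M) :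
    differential H x (S.hamiltonianVectorField H x) = 0 := by
  rw [← S.hamiltonianVectorField_spec]
  linarith [S.omega_swap x (S.hamiltonianVectorField H x) (S.hamiltonianVectorField H x)]

/-- The pairing `i_{X_H} θ` read in a chart, as an expression in the local representatives of
`ω`, `θ` and `H`. -/
theorem theta_hamiltonianVectorField_chart [FiniteDimensional ℝ E] [IsManifold 𝓘(ℝ, E) ∞ M]
    (S : ExactSymplectic E M) {H : M → ℝ} (hH : MDifferentiable 𝓘(ℝ, E) 𝓘(ℝ, ℝ) H) (x₀ : M)
    {y : E} (hy : y ∈ (extChartAt 𝓘(ℝ, E) x₀).target) :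
    (S.omega.inChart x₀ y).interiorProduct.IsInvertible ∧
    S.theta ((extChartAt 𝓘(ℝ, E) x₀).symm y)
      ![S.hamiltonianVectorField H ((extChartAt 𝓘(ℝ, E) x₀).symm y)] =
    S.theta.inChart x₀ y ![(S.omega.inChart x₀ y).interiorProduct.inverse
      (fderiv ℝ (H ∘ (extChartAt 𝓘(ℝ, E) x₀).symm) y)] := by
  have : IsManifold 𝓘(ℝ, E) 1 M := IsManifold.of_le (n := ∞) (by norm_num)
  have hinv := isInvertible_mfderivWithin_extChartAt_symm (I := 𝓘(ℝ, E)) hy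
  have hdiff := mdifferentiableWithinAt_extChartAt_symm (I := 𝓘(ℝ, E)) hy
  simp only [modelWithCornersSelf_coe, range_id, mfderivWithin_univ,
    mdifferentiableWithinAt_univ] at hinv hdiff
  have hdH : fderiv ℝ (H ∘ (extChartAt 𝓘(ℝ, E) x₀).symm) y =
      (differential H ((extChartAt 𝓘(ℝ, E) x₀).symm y) : E →L[ℝ] ℝ) ∘L
        (mfderiv 𝓘(ℝ, E) 𝓘(ℝ, E) (extChartAt 𝓘(ℝ, E) x₀).symm y : E →L[ℝ] E) :=
    HasFDerivAt.fderiv (E := E) (F := ℝ)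
      ((hH _).hasMFDerivAt.comp y hdiff.hasMFDerivAt).hasFDerivAt
  rw [hdH]
  exact ContinuousAlternatingMap.apply_eq_inverse_interiorProduct (E := E)
    (S.omega ((extChartAt 𝓘(ℝ, E) x₀).symm y)) (S.nondegenerate _)
    (S.theta ((extChartAt 𝓘(ℝ, E) x₀).symm y)) (S.hamiltonianVectorField_spec H _) hinv

/-- The function `i_{X_H} θ` is continuous. -/
theorem continuous_theta_hamiltonianVectorField [FiniteDimensional ℝ E]
    [IsManifold 𝓘(ℝ, E) ∞ M] (S : ExactSymplectic E M) {H : M → ℝ}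
    (hH : ContMDiff 𝓘(ℝ, E) 𝓘(ℝ, ℝ) ∞ H) :
    Continuous fun x => S.theta x ![S.hamiltonianVectorField H x] := by
  have : CompleteSpace E := FiniteDimensional.complete ℝ E
  have hmd : MDifferentiable 𝓘(ℝ, E) 𝓘(ℝ, ℝ) H := hH.mdifferentiable (by simp)
  rw [continuous_iff_continuousAt]
  intro x₀
  set φ := extChartAt 𝓘(ℝ, E) x₀
  have hopen : IsOpen φ.target := isOpen_extChartAt_target x₀
  have hB : ContinuousOn (fun y => (S.omega.inChart x₀ y).interiorProduct) φ.target :=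
    (S.smooth_omega x₀).continuousOn.interiorProduct
  have hT : ContinuousOn (S.theta.inChart x₀) φ.target := (S.smooth_theta x₀).continuousOn
  have hℓ : ContinuousOn (fderiv ℝ (H ∘ φ.symm)) φ.target := by
    have h : ContDiffOn ℝ ∞ (H ∘ φ.symm) φ.target :=
      (hH.comp_contMDiffOn (contMDiffOn_extChartAt_symm x₀)).contDiffOn
    exact h.continuousOn_fderiv_of_isOpen hopen (by simp)
  have hg : ContinuousOn (fun y => S.theta.inChart x₀ y
      ![(S.omega.inChart x₀ y).interiorProduct.inverse (fderiv ℝ (H ∘ φ.symm) y)])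
      φ.target := by
    have hI : ContinuousOn (fun y => (S.omega.inChart x₀ y).interiorProduct.inverse)
        φ.target := fun y hy =>
      -- `inverse` is total, with value 0 off the invertible maps, so its continuity is used only at
      -- points where nondegeneracy gives invertibility.
      ContinuousAt.comp_continuousWithinAt (f := fun y => (S.omega.inChart x₀ y).interiorProduct)
        ((S.theta_hamiltonianVectorField_chart hmd x₀ hy).1.contDiffAt_map_inverse
          (n := 0)).continuousAt (hB y hy)
    refine hT.eval (continuousOn_pi.2 fun i => ?_)
    fin_cases i
    exact hI.clm_apply hℓ
  have hx₀ : φ x₀ ∈ φ.target := mem_extChartAt_target x₀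
  refine ((hg.continuousAt (hopen.mem_nhds hx₀)).comp
    (continuousAt_extChartAt (I := 𝓘(ℝ, E)) x₀)).congr ?_
  filter_upwards [extChartAt_source_mem_nhds (I := 𝓘(ℝ, E)) x₀] with x hx
  have h := (S.theta_hamiltonianVectorField_chart hmd x₀ (φ.map_source hx)).2
  rw [φ.left_inv hx] at h
  exact h.symm

end ExactSymplectic

/-! ### Derivatives along group orbits and integral curves. -/

theorem PosReal.contMDiff_exp : ContMDiff 𝓘(ℝ, ℝ) 𝓘(ℝ, ℝ) ∞ PosReal.exp := by
  have : Nonempty PosReal := ⟨⟨1, one_pos⟩⟩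
  -- The inclusion into ℝ is the global chart, so smoothness reduces to that of `Real.exp`.
  exact ContMDiff.of_comp_isOpenEmbedding
    (isOpen_Ioi (a := (0 : ℝ))).isOpenEmbedding_subtypeVal Real.contDiff_exp.contMDiff

section Derivatives

variable {E : Type*} [NormedAddCommGroup E] [NormedSpace ℝ E]
  {M : Type*} [TopologicalSpace M] [ChartedSpace E M]

/-- The separate base point x serves orbit curves, whose value at 0 is x only after rewriting
e^{0·ξ} = 1. -/
theorem hasDerivAt_comp_of_hasMFDerivAt {F : M → ℝ} {γ : ℝ → M} {t : ℝ} {x : M} (hx : γ t = x)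
    (hF : MDifferentiableAt 𝓘(ℝ, E) 𝓘(ℝ, ℝ) F x) {D : ℝ →L[ℝ] E} (hγ : HasMFDerivAt 𝓘(ℝ, ℝ) 𝓘(ℝ, E) γ t D) :
    HasDerivAt (fun s => F (γ s)) (differential F x (D 1 : E)) t := by
  subst hx
  exact HasFDerivAt.hasDerivAt (𝕜 := ℝ) (F := ℝ) (hF.hasMFDerivAt.comp t hγ).hasFDerivAt

theorem differential_infinitesimalGenerator [MulAction PosReal M]
    [ContMDiffSMul 𝓘(ℝ, ℝ) 𝓘(ℝ, E) ∞ PosReal M] {b : ℝ} {H : M → ℝ}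
    (hH : MDifferentiable 𝓘(ℝ, E) 𝓘(ℝ, ℝ) H) (hinv : IsConformallyInvariant b H)
    (ξ : ℝ) (x : M) :
    differential H x (infinitesimalGenerator E ξ x) = b * ξ * H x := by
  -- `mfderiv` defaults to 0, so the generator is the true velocity only once the orbit is known to
  -- be differentiable.
  have hcurve : MDifferentiableAt 𝓘(ℝ, ℝ) 𝓘(ℝ, E) (fun τ : ℝ => PosReal.exp (τ * ξ) • x) 0 := by
    have h : ContMDiff 𝓘(ℝ, ℝ) 𝓘(ℝ, ℝ) ∞ fun τ : ℝ => PosReal.exp (τ * ξ) :=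
      PosReal.contMDiff_exp.comp (contDiff_id.mul contDiff_const).contMDiff
    exact (h.smul (contMDiff_const (c := x))).mdifferentiable (by simp) 0
  have hx : PosReal.exp (0 * ξ) • x = x := by
    have : PosReal.exp (0 * ξ) = 1 := Subtype.ext (by simp [PosReal.exp])
    rw [this, one_smul]
  have h₁ := hasDerivAt_comp_of_hasMFDerivAt (γ := fun τ : ℝ => PosReal.exp (τ * ξ) • x)
    hx (hH x) hcurve.hasMFDerivAt
  have h₂ : HasDerivAt (fun τ : ℝ => H (PosReal.exp (τ * ξ) • x)) (b * ξ * H x) 0 := by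
    have e : (fun τ : ℝ => H (PosReal.exp (τ * ξ) • x)) =
        fun τ => Real.exp (τ * (ξ * b)) * H x := by
      funext τ
      rw [hinv]
      change Real.exp (τ * ξ) ^ b * H x = _
      rw [← Real.exp_mul, mul_assoc]
    rw [e]
    have h := (((hasDerivAt_id (0 : ℝ)).mul_const (ξ * b)).exp).mul_const (H x)
    simpa [mul_comm ξ b] using h
  exact h₁.unique h₂

theorem IsMIntegralCurveOn.hasDerivAt_comp {v : (x : M) → TangentSpace 𝓘(ℝ, E) x}
    {γ : ℝ → M} {s : Set ℝ} (hγ : IsMIntegralCurveOn (I := 𝓘(ℝ, E)) γ v s) (hs : IsOpen s)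
    {F : M → ℝ} (hF : MDifferentiable 𝓘(ℝ, E) 𝓘(ℝ, ℝ) F) {t : ℝ} (ht : t ∈ s) :
    HasDerivAt (fun r => F (γ r)) (differential F (γ t) (v (γ t))) t := by
  have h := hasDerivAt_comp_of_hasMFDerivAt rfl (hF (γ t))
    ((hγ t ht).hasMFDerivAt (hs.mem_nhds ht))
  refine h.congr_deriv (congrArg (differential F (γ t)) ?_)
  -- The derivative of an integral curve is the map r ↦ r • v, evaluated here at r = 1.
  exact one_smul ℝ (v (γ t) : E)

end Derivatives

/-! ### Noether's identity and the constant of motion. -/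

/-- The derivative of a conformal momentum map in the direction of the Hamiltonian vector field
of a conformally invariant function. -/
theorem ExactSymplectic.IsConformalMomentumMap.differential_hamiltonianVectorField
    {E : Type*} [NormedAddCommGroup E] [NormedSpace ℝ E] [FiniteDimensional ℝ E]
    {M : Type*} [TopologicalSpace M] [ChartedSpace E M] {S : ExactSymplectic E M}
    [MulAction PosReal M] [ContMDiffSMul 𝓘(ℝ, ℝ) 𝓘(ℝ, E) ∞ PosReal M]
    {b c : ℝ} {J : M → ℝ} (hJ : S.IsConformalMomentumMap c J) {H : M → ℝ}
    (hH : MDifferentiable 𝓘(ℝ, E) 𝓘(ℝ, ℝ) H) (hinv : IsConformallyInvariant b H) (x : M) :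
    differential J x (S.hamiltonianVectorField H x) =
      -b * H x + c * S.theta x ![S.hamiltonianVectorField H x] := by
  have h := hJ.interior_add 1 x (S.hamiltonianVectorField H x)
  rw [S.omega_swap, S.hamiltonianVectorField_spec,
    differential_infinitesimalGenerator hH hinv] at h
  simp only [one_mul, mul_one] at h
  linarith

theorem mainTheorem5
    {E : Type*} [NormedAddCommGroup E] [NormedSpace ℝ E] [FiniteDimensional ℝ E]
    {M : Type*} [TopologicalSpace M] [ChartedSpace E M] [IsManifold 𝓘(ℝ, E) ∞ M]
    (S : ExactSymplectic E M)
    [MulAction PosReal M] [ContMDiffSMul 𝓘(ℝ, ℝ) 𝓘(ℝ, E) ∞ PosReal M]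
    (b c : ℝ) (hΦ : S.IsConformallySymplecticAction c)
    (J : M → ℝ) (hJ : S.IsConformalMomentumMap c J)
    (H : M → ℝ) (hH : ContMDiff 𝓘(ℝ, E) 𝓘(ℝ, ℝ) ∞ H) (hinv : IsConformallyInvariant b H)
    (I : Set ℝ) (hIopen : IsOpen I) (hIconn : I.OrdConnected) (h0 : (0 : ℝ) ∈ I)
    (γ : ℝ → M) (hγ : IsMIntegralCurveOn (I := 𝓘(ℝ, E)) γ (S.hamiltonianVectorField H) I) :
    (∀ t ∈ I, HasDerivAt (fun s => J (γ s))
      (-b * H (γ t) + c * S.theta (γ t) ![S.hamiltonianVectorField H (γ t)]) t) ∧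
    (∀ t ∈ I, IntervalIntegrable
      (fun s => S.theta (γ s) ![S.hamiltonianVectorField H (γ s)]) MeasureTheory.volume 0 t) ∧
    (∀ t ∈ I, HasDerivAt
      (fun t : ℝ => J (γ t) + b * H (γ t) * t
        - c * ∫ s in (0 : ℝ)..t, S.theta (γ s) ![S.hamiltonianVectorField H (γ s)]) 0 t) ∧
    (∀ t ∈ I, J (γ t) + b * H (γ t) * t
        - c * (∫ s in (0 : ℝ)..t, S.theta (γ s) ![S.hamiltonianVectorField H (γ s)])
      = J (γ 0)) := by
  have hmd : MDifferentiable 𝓘(ℝ, E) 𝓘(ℝ, ℝ) H := hH.mdifferentiable (by simp)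
  set f : ℝ → ℝ := fun s => S.theta (γ s) ![S.hamiltonianVectorField H (γ s)]
  have hdJ : ∀ t ∈ I, HasDerivAt (fun s => J (γ s)) (-b * H (γ t) + c * f t) t := by
    intro t ht
    have h := hγ.hasDerivAt_comp hIopen (hJ.smooth.mdifferentiable (by simp)) ht
    rwa [hJ.differential_hamiltonianVectorField hmd hinv] at h
  have hdH : ∀ t ∈ I, HasDerivAt (fun s => H (γ s)) 0 t := by
    intro t ht
    have h := hγ.hasDerivAt_comp hIopen hmd ht
    rwa [S.differential_hamiltonianVectorField_self] at h
  have hcont : ContinuousOn f I :=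
    (S.continuous_theta_hamiltonianVectorField hH).comp_continuousOn hγ.continuousOn
  have hint : ∀ t ∈ I, IntervalIntegrable f MeasureTheory.volume 0 t := fun t ht =>
    (hcont.mono (hIconn.uIcc_subset h0 ht)).intervalIntegrable
  have hdF : ∀ t ∈ I, HasDerivAt
      (fun t : ℝ => J (γ t) + b * H (γ t) * t - c * ∫ s in (0 : ℝ)..t, f s) 0 t := by
    intro t ht
    have hI := intervalIntegral.integral_hasDerivAt_right (hint t ht)
      (hcont.stronglyMeasurableAtFilter hIopen t ht) (hcont.continuousAt (hIopen.mem_nhds ht))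
    have h := ((hdJ t ht).add (((hdH t ht).const_mul b).mul (hasDerivAt_id t))).sub
      (hI.const_mul c)
    refine h.congr_deriv ?_
    -- The derivative is (-bH + cf) + bH - cf, using dH/dt = 0.
    simp
  refine ⟨hdJ, hint, hdF, fun t ht => ?_⟩
  have h := hIopen.is_const_of_deriv_eq_zero hIconn.isPreconnected
    (fun s hs => (hdF s hs).differentiableAt.differentiableWithinAt)
    (fun s hs => (hdF s hs).deriv) ht h0
  -- At time 0 the term bHt and the integral vanish, leaving J(γ(0)).
  simpa using h
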